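/- Let $\mathcal P=(\mathcal P,d,\mu)$ be a metric space equipped with (the completion of) a Borel measure $\mu$ such that $0<\mu(B)<\infty$ for every ball $B\subset\mathcal P$. Write $\overline{\mathbf R}=[-\infty,\infty]$. A Borel function $g:\mathcal P\to[0,\infty]$ is an *upper gradient* of $u:\mathcal P\to\overline{\mathbf R}$ if $|u(\gamma(0))-u(\gamma(l_\gamma))|\le\int_\gamma g\,ds$ for every nonconstant rectifiable curve $\gamma:[0,l_\gamma]\to\mathcal P$ parametrized by arc length, with the convention $|(\pm\infty)-(\pm\infty)|=\infty$. The space $N^{1,\infty}(\mathcal P)$ consists of all everywhere defined measurable $u:\mathcal P\to\overline{\mathbf R}$ such that $$\|u\|_{N^{1,\infty}}:=\|u\|_{L^\infty(\mu)}+\inf_g\|g\|_{L^\infty(\mu)}<\infty,$$ where the infimum is taken over all upper gradients $g$ of $u$. For $E\subset\mathcal P$ let $$C_\infty(E)=\inf\{\|u\|_{N^{1,\infty}}:u\in N^{1,\infty}(\mathcal P),\ u\ge1\text{ on }E\}.$$ For $c\ge1$, $C_\infty$ is a *$c$-quasiouter capacity* if $\inf\{C_\infty(G):G\supset E,\ G\text{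 open}\}\le c\,C_\infty(E)$ for every $E\subset\mathcal P$; it is a *quasiouter capacity* if this holds for some $c\ge 1$, and an *outer capacity* if it holds for $c=1$. A function $u:\mathcal P\to\overline{\mathbf R}$ is *weakly quasicontinuous* if for every $\varepsilon>0$ there is $E\subset\mathcal P$ with $C_\infty(E)<\varepsilon$ such that $u|_{\mathcal P\setminus E}$ is real-valued and continuous; $u$ is *quasicontinuous* if, for every $\varepsilon>0$, $E$ can moreover be chosen open. Consider the following statements about $\mathcal P$: - (A) Every $u\in N^{1,\infty}(\mathcal P)$ is quasicontinuous. - (B) $C_\infty$ is an outer capacity. - (C) $C_\infty$ is a quasiouter capacity. - (D) Every weakly quasicontinuous $u:\mathcal P\to\overline{\mathbf R}$ is quasicontinuous. - (E) $C_\infty$ is an outer capacity for sets of zero capacity, i.e. whenever $C_\infty(E)=0$ and $\varepsilon>0$, there is an open set $G\supset E$ with $C_\infty(G)<\varepsilon$. - (F) Every $u\in N^{1,\infty}(\mathcal P)$ has a quasicontinuous representative $v$, i.e. a quasicontinuous $v:\mathcal P\to\overline{\mathbf R}$ with $C_\infty(\{x:v(x)\ne u(x)\})=0$. - (G) Every $u\in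 N^{1,\infty}(\mathcal P)$ is weakly quasicontinuous. - (H) $C_\infty(E)>0$ for every nonempty set $E\subset\mathcal P$. Then, for every such $\mathcal P$, the statements (B), (C), (D), (E) and (H) are equivalent, and $$\text{(A)}\Leftrightarrow(\text{(B) and (G)}),\qquad \text{(A)}\Rightarrow\text{(B)},\qquad \text{(A)}\Rightarrow\text{(F)},\qquad \text{(F)}\Rightarrow\text{(G)}.$$ On the other hand, none of the implications (B)$\Rightarrow$(A), (G)$\Rightarrow$(B), (B)$\Rightarrow$(G), (G)$\Rightarrow$(F) holds in general: for each of them there is such a $\mathcal P$ for which it fails. Moreover, there is such a $\mathcal P$ for which all of the statements (A)–(H) fail. -/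

import Mathlib

open MeasureTheory Set
open scoped ENNReal NNReal

namespace NewtonianLinfty

section Defs

variable {P : Type*} [MetricSpace P] [MeasurableSpace P]

/-- The standing assumption on the measure: every ball has positive and finite measure.
Below `P` carries its Borel `σ`-algebra. The associated complete Borel measure is the completion
of `μ`; measurability with respect to that completion is `NullMeasurable`, and `μ` evaluated at an
arbitrary set is the associated (Borel regular) outer measure. -/
def BallsPosFinite (μ : Measure P) : Prop :=
  ∀ (x : P) (r : ℝ), 0 < r → 0 < μ (Metric.ball x r) ∧ μ (Metric.ball x r) < ∞

/-- `γ` restricted to `[0, l]` is a nonconstant rectifiable curve of length `l`, parametrized by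
arc length. -/
def IsArcLengthCurve (γ : ℝ → P) (l : ℝ) : Prop :=
  0 < l ∧ HasUnitSpeedOn γ (Icc 0 l)

/-- A Borel function `g : P → [0, ∞]` is an upper gradient of `u : P → [-∞, ∞]` if
`|u (γ 0) - u (γ l)| ≤ ∫_γ g ds` for every nonconstant rectifiable curve `γ` in `P`.
In `EReal` one has `⊤ - ⊤ = ⊥ - ⊥ = ⊥`, so that the left-hand side is `∞` in these cases
(see `abs_top_sub_top` and `abs_bot_sub_bot`). -/
def IsUpperGradient (g : P → ℝ≥0∞) (u : P → EReal) : Prop :=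
  Measurable g ∧ ∀ (γ : ℝ → P) (l : ℝ), IsArcLengthCurve γ l →
    (u (γ 0) - u (γ l)).abs ≤ ∫⁻ t in Icc 0 l, g (γ t)

theorem abs_top_sub_top : ((⊤ : EReal) - ⊤).abs = ∞ := by simp

theorem abs_bot_sub_bot : ((⊥ : EReal) - ⊥).abs = ∞ := by simp

/-- The `N^{1,∞}` (semi)norm `‖u‖_∞ + inf_g ‖g‖_∞`, the infimum being taken over all upper
gradients `g` of `u`. -/
noncomputable def newtonNorm (μ : Measure P) (u : P → EReal) : ℝ≥0∞ :=
  essSup (fun x => (u x).abs) μ + ⨅ (g : P → ℝ≥0∞) (_ : IsUpperGradient g u), essSup g μ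

/-- `u` belongs to the Newtonian space `N^{1,∞}(P)`; functions are defined everywhere and take
values in `[-∞, ∞]`. -/
def MemNewton (μ : Measure P) (u : P → EReal) : Prop :=
  NullMeasurable u μ ∧ newtonNorm μ u < ∞

/-- The Sobolev capacity `C_∞(E) = inf {‖u‖_{N^{1,∞}} : u ≥ 1 on E}`. -/
noncomputable def capacity (μ : Measure P) (E : Set P) : ℝ≥0∞ :=
  ⨅ (u : P → EReal) (_ : MemNewton μ u ∧ ∀ x ∈ E, 1 ≤ u x), newtonNorm μ u

/-- The restriction of `u` to `s` is a (real-valued) continuous function. -/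
def IsContOn (u : P → EReal) (s : Set P) : Prop :=
  (∀ x ∈ s, u x ≠ ⊥ ∧ u x ≠ ⊤) ∧ ContinuousOn u s

def WeaklyQuasicontinuous (μ : Measure P) (u : P → EReal) : Prop :=
  ∀ ε : ℝ≥0∞, 0 < ε → ∃ E : Set P, capacity μ E < ε ∧ IsContOn u Eᶜ

def Quasicontinuous (μ : Measure P) (u : P → EReal) : Prop :=
  ∀ ε : ℝ≥0∞, 0 < ε → ∃ E : Set P, IsOpen E ∧ capacity μ E < ε ∧ IsContOn u Eᶜ

/-- `C_∞` is a `c`-quasiouter capacity. -/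
def IsQuasiouterWith (μ : Measure P) (c : ℝ≥0) : Prop :=
  ∀ E : Set P, ⨅ (G : Set P) (_ : IsOpen G ∧ E ⊆ G), capacity μ G ≤ c * capacity μ E

/-- (A) Every `u ∈ N^{1,∞}(P)` is quasicontinuous. -/
def PropA (μ : Measure P) : Prop :=
  ∀ u : P → EReal, MemNewton μ u → Quasicontinuous μ u

/-- (B) `C_∞` is an outer capacity. -/
def PropB (μ : Measure P) : Prop := IsQuasiouterWith μ 1

/-- (C) `C_∞` is a quasiouter capacity. -/
def PropC (μ : Measure P) : Prop := ∃ c : ℝ≥0, 1 ≤ c ∧ IsQuasiouterWith μ c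

/-- (D) Every weakly quasicontinuous `u : P → [-∞, ∞]` is quasicontinuous. -/
def PropD (μ : Measure P) : Prop :=
  ∀ u : P → EReal, WeaklyQuasicontinuous μ u → Quasicontinuous μ u

/-- (E) `C_∞` is an outer capacity for sets of zero capacity. -/
def PropE (μ : Measure P) : Prop :=
  ∀ E : Set P, capacity μ E = 0 → ∀ ε : ℝ≥0∞, 0 < ε →
    ∃ G : Set P, IsOpen G ∧ E ⊆ G ∧ capacity μ G < ε

/-- (F) Every `u ∈ N^{1,∞}(P)` has a quasicontinuous representative `v`, i.e. `v = u` outside a set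
of zero capacity. -/
def PropF (μ : Measure P) : Prop :=
  ∀ u : P → EReal, MemNewton μ u →
    ∃ v : P → EReal, Quasicontinuous μ v ∧ capacity μ {x | v x ≠ u x} = 0

/-- (G) Every `u ∈ N^{1,∞}(P)` is weakly quasicontinuous. -/
def PropG (μ : Measure P) : Prop :=
  ∀ u : P → EReal, MemNewton μ u → WeaklyQuasicontinuous μ u

/-- (H) Every nonempty set has positive capacity. -/
def PropH (μ : Measure P) : Prop :=
  ∀ E : Set P, E.Nonempty → 0 < capacity μ E

end Defs

/-- There is a metric space with a Borel measure, satisfying the standing assumption, for which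
`Q` holds. -/
def ExistsSpace
    (Q : ∀ (P : Type) [MetricSpace P] [MeasurableSpace P], Measure P → Prop) : Prop :=
  ∃ (P : Type) (_ : MetricSpace P) (_ : MeasurableSpace P) (_ : BorelSpace P) (μ : Measure P),
    BallsPosFinite μ ∧ Q P μ

end NewtonianLinfty

/-! The capacity takes only the values 0 and 1. If `capacity μ E < 1`, choose `u ≥ 1` on `E` with an
upper gradient `g` such that the essential suprema of `|u|` and `g` have sum below 1, and let `N` be
a null set off which both bounds hold pointwise. A curve starting in `E` must spend positive time in
`N`: otherwise a short initial piece would bring `u` from at least 1 into the bounded range at too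
small a cost. Hence `∞ · 1_N` is an upper gradient of `∞ · 1_E`, and both vanish a.e.

Nonempty open sets have positive measure, hence capacity 1. So quasicontinuity is real-valued
continuity everywhere, and each of (B)–(E) fails as soon as a nonempty set has zero capacity.
Conversely, under (H) a set of capacity below 1 is empty, hence open.

The counterexamples are totally disconnected, so there are no curves, 0 is always an upper gradient,
and null sets have zero capacity. Only the interplay of topology and null sets remains. -/

namespace NewtonianLinfty

/-! ### Extended-real arithmetic and arc-length curves. -/

section General

variable {P : Type*} [MetricSpace P]

theorem abs_le_abs_add_abs_sub (x y : EReal) : x.abs ≤ y.abs + (x - y).abs := by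
  induction x with
  | bot => induction y <;> simp
  | top => induction y <;> simp
  | coe x =>
    induction y with
    | bot => simp
    | top => simp
    | coe y =>
      rw [← EReal.coe_sub, EReal.abs_def, EReal.abs_def, EReal.abs_def,
        ← ENNReal.ofReal_add (abs_nonneg _) (abs_nonneg _)]
      refine ENNReal.ofReal_le_ofReal ?_
      have := abs_add_le y (x - y)
      rwa [add_sub_cancel] at this

theorem one_le_abs_of_one_le {x : EReal} (hx : 1 ≤ x) : 1 ≤ x.abs := by
  induction x with
  | bot => exact absurd hx (not_le.2 (EReal.bot_lt_coe 1))
  | top => simp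
  | coe x =>
    rw [EReal.abs_def, ENNReal.one_le_ofReal]
    exact (by exact_mod_cast hx : (1 : ℝ) ≤ x).trans (le_abs_self x)

theorem measure_eq_zero_of_one_le {P : Type*} [MeasurableSpace P] {μ : Measure P} {u : P → EReal} {E : Set P} (hE : ∀ x ∈ E, 1 ≤ u x)
    (hu : essSup (fun x => (u x).abs) μ < 1) : μ E = 0 := by
  refine measure_mono_null (fun x hx => ?_) (ae_iff.1 (ae_lt_of_essSup_lt hu))
  exact not_lt.2 (one_le_abs_of_one_le (hE x hx))

theorem setLIntegral_reverse (f : ℝ → ℝ≥0∞) (l : ℝ) :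
    ∫⁻ t in Icc 0 l, f (l - t) = ∫⁻ t in Icc 0 l, f t := by
  have := (Measure.measurePreserving_sub_left volume l).setLIntegral_comp_emb
    (MeasurableEquiv.subLeft l).measurableEmbedding f (Icc 0 l)
  rw [this]
  simp

theorem IsArcLengthCurve.continuousOn {γ : ℝ → P} {l : ℝ} (h : IsArcLengthCurve γ l) :
    ContinuousOn γ (Icc 0 l) := by
  have key : ∀ x ∈ Icc (0 : ℝ) l, ∀ y ∈ Icc (0 : ℝ) l, x ≤ y →
      edist (γ x) (γ y) ≤ edist x y := by
    intro x hx y hy hxy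
    have h1 := eVariationOn.edist_le γ (s := Icc 0 l ∩ Icc x y) (x := x) (y := y)
      ⟨hx, left_mem_Icc.2 hxy⟩ ⟨hy, right_mem_Icc.2 hxy⟩
    rw [h.2 hx hy] at h1
    refine h1.trans ?_
    rw [edist_comm, edist_dist, Real.dist_eq, abs_of_nonneg (sub_nonneg.2 hxy)]
    simp
  have : LipschitzOnWith 1 γ (Icc 0 l) := by
    intro x hx y hy
    rw [ENNReal.coe_one, one_mul]
    rcases le_total x y with hxy | hxy
    · exact key x hx y hy hxy
    · rw [edist_comm, edist_comm x]
      exact key y hy x hx hxy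
  exact this.continuousOn

theorem IsArcLengthCurve.restrict {γ : ℝ → P} {l s : ℝ} (h : IsArcLengthCurve γ l) (hs : 0 < s)
    (hsl : s ≤ l) : IsArcLengthCurve γ s := by
  refine ⟨hs, fun x hx y hy => ?_⟩
  rw [← h.2 ⟨hx.1, hx.2.trans hsl⟩ ⟨hy.1, hy.2.trans hsl⟩]
  congr 1
  ext t
  simp only [mem_inter_iff, mem_Icc] at hx hy ⊢
  constructor
  · rintro ⟨⟨_, _⟩, _, _⟩
    refine ⟨⟨?_, ?_⟩, ?_, ?_⟩ <;> linarith
  · rintro ⟨⟨_, _⟩, _, _⟩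
    refine ⟨⟨?_, ?_⟩, ?_, ?_⟩ <;> linarith

theorem IsArcLengthCurve.reverse {γ : ℝ → P} {l : ℝ} (h : IsArcLengthCurve γ l) :
    IsArcLengthCurve (fun t => γ (l - t)) l := by
  refine ⟨h.1, fun x hx y hy => ?_⟩
  have hanti : AntitoneOn (fun t : ℝ => l - t) (Icc 0 l ∩ Icc x y) :=
    fun a _ b _ hab => sub_le_sub_left hab l
  have := eVariationOn.comp_eq_of_antitoneOn γ (fun t : ℝ => l - t) hanti
  have himg : (fun t : ℝ => l - t) '' (Icc 0 l ∩ Icc x y) = Icc 0 l ∩ Icc (l - y) (l - x) := by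
    rw [image_inter (fun a b hab => by simpa using hab)]
    simp
  have e : (fun t => γ (l - t)) = γ ∘ fun t => l - t := rfl
  rw [e, this, himg, h.2 ⟨by linarith [hy.2], by linarith [hy.1]⟩
    ⟨by linarith [hx.2], by linarith [hx.1]⟩]
  congr 2
  ring

/-- The image of an interval is connected, hence a single point, so its variation is 0 rather than
`l > 0`. -/
theorem not_isArcLengthCurve [TotallyDisconnectedSpace P] (γ : ℝ → P) (l : ℝ) :
    ¬ IsArcLengthCurve γ l := by
  intro h
  have hsub : (γ '' Icc 0 l).Subsingleton :=
    (isPreconnected_Icc.image γ h.continuousOn).subsingleton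
  have h0 := h.2 (left_mem_Icc.2 h.1.le) (right_mem_Icc.2 h.1.le)
  rw [inter_self, eVariationOn.constant_on hsub] at h0
  have := h.1
  simp at h0
  linarith

variable [MeasurableSpace P]

/-- A finite integral would put almost every `γ t` outside `N`. Some early `s` then gives `1 ≤ |u (γ
0)| ≤ |u (γ s)| + ∫ g ≤ a + b < 1`. -/
theorem lintegral_indicator_top_eq_top [BorelSpace P] {g : P → ℝ≥0∞} {u : P → EReal} (hg : IsUpperGradient g u)
    {a b : ℝ≥0∞} (hab : a + b < 1) {N : Set P} (hN : MeasurableSet N)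
    (hNu : ∀ x ∉ N, (u x).abs ≤ a ∧ g x ≤ b) {γ : ℝ → P} {l : ℝ} (hγ : IsArcLengthCurve γ l)
    (h0 : 1 ≤ u (γ 0)) : ∫⁻ t in Icc 0 l, N.indicator (fun _ => ∞) (γ t) = ∞ := by
  by_contra hfin
  have hmeas : AEMeasurable (fun t => N.indicator (fun _ => (∞ : ℝ≥0∞)) (γ t))
      (volume.restrict (Icc 0 l)) :=
    (measurable_const.indicator hN).comp_aemeasurable (hγ.continuousOn.aemeasurable measurableSet_Icc)
  have hae : ∀ᵐ t ∂volume.restrict (Icc 0 l), γ t ∉ N := by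
    filter_upwards [ae_lt_top' hmeas hfin] with t ht hmem
    simp [hmem] at ht
  -- Stopping at length at most 1 keeps the integral of `g ≤ b` below `b`.
  have hm : 0 < min 1 l := lt_min one_pos hγ.1
  have hsub : Ioc 0 (min 1 l) ⊆ Icc 0 l := fun t ht => ⟨ht.1.le, ht.2.trans (min_le_right _ _)⟩
  obtain ⟨s, hsN, hs⟩ : ∃ s, γ s ∉ N ∧ s ∈ Ioc 0 (min 1 l) := by
    have : (ae (volume.restrict (Ioc 0 (min 1 l)))).NeBot := by
      rw [ae_neBot, Ne, Measure.restrict_eq_zero]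
      simp [hγ.1]
    exact ((ae_restrict_of_ae_restrict_of_subset hsub hae).and
      (ae_restrict_mem measurableSet_Ioc)).exists
  have hs1 : s ≤ 1 := hs.2.trans (min_le_left _ _)
  have hint : ∫⁻ t in Icc 0 s, g (γ t) ≤ b := by
    calc ∫⁻ t in Icc 0 s, g (γ t) ≤ ∫⁻ _ in Icc 0 s, b := by
          refine lintegral_mono_ae ?_
          filter_upwards [ae_restrict_of_ae_restrict_of_subset
            (Icc_subset_Icc_right (hs.2.trans (min_le_right _ _))) hae] with t ht
          exact (hNu _ ht).2
      _ = b * ENNReal.ofReal s := by simp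
      _ ≤ b * 1 := by gcongr; simpa using hs1
      _ = b := mul_one b
  have := calc (1 : ℝ≥0∞) ≤ (u (γ 0)).abs := one_le_abs_of_one_le h0
    _ ≤ (u (γ s)).abs + (u (γ 0) - u (γ s)).abs := abs_le_abs_add_abs_sub _ _
    _ ≤ a + b := add_le_add (hNu _ hsN).1
        ((hg.2 γ s (hγ.restrict hs.1 (hs.2.trans (min_le_right _ _)))).trans hint)
  exact this.not_gt hab

/-! ### Zero-one law for the capacity and the equivalences. -/

variable {μ : Measure P}

theorem one_le_capacity_of_measure_ne_zero {E : Set P} (hE : μ E ≠ 0) : 1 ≤ capacity μ E := by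
  refine le_iInf₂ fun u hu => ?_
  by_contra! h
  exact hE (measure_eq_zero_of_one_le hu.2 (lt_of_le_of_lt le_self_add h))

theorem capacity_le {E : Set P} {u : P → EReal} (hu : MemNewton μ u) (hE : ∀ x ∈ E, 1 ≤ u x) :
    capacity μ E ≤ newtonNorm μ u :=
  iInf₂_le u ⟨hu, hE⟩

theorem Quasicontinuous.weakly {u : P → EReal} (h : Quasicontinuous μ u) :
    WeaklyQuasicontinuous μ u := fun ε hε =>
  let ⟨E, _, hcap, hu⟩ := h ε hε
  ⟨E, hcap, hu⟩

theorem newtonNorm_eq_essSup {u : P → EReal} (hu : IsUpperGradient 0 u) :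
    newtonNorm μ u = essSup (fun x => (u x).abs) μ := by
  have : (⨅ (g : P → ℝ≥0∞) (_ : IsUpperGradient g u), essSup g μ) = 0 :=
    le_antisymm ((iInf₂_le 0 hu).trans_eq (ENNReal.essSup_eq_zero_iff.2 (by rfl))) zero_le
  rw [newtonNorm, this, add_zero]

theorem capacity_le_one (E : Set P) : capacity μ E ≤ 1 := by
  have hu : newtonNorm μ (fun _ : P => (1 : EReal)) ≤ 1 := by
    rw [newtonNorm_eq_essSup ⟨measurable_zero, fun γ l _ => ?_⟩]
    · refine essSup_le_of_ae_le _ (Filter.Eventually.of_forall fun x => ?_)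
      have := EReal.abs_def 1
      simp at this
      simp [this]
    · rw [← EReal.coe_one, ← EReal.coe_sub]
      simp
  exact (capacity_le ⟨measurable_const.nullMeasurable, hu.trans_lt ENNReal.one_lt_top⟩
    fun _ _ => le_rfl).trans hu

theorem capacity_empty : capacity μ (∅ : Set P) = 0 := by
  have hu : newtonNorm μ (fun _ : P => (0 : EReal)) = 0 := by
    rw [newtonNorm_eq_essSup ⟨measurable_zero, fun γ l _ => by simp⟩]
    rw [ENNReal.essSup_eq_zero_iff]
    exact Filter.Eventually.of_forall fun x => by simp
  refine le_antisymm ((capacity_le ⟨measurable_const.nullMeasurable, by simp [hu]⟩ ?_).trans_eq hu)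
    zero_le
  simp

theorem PropA.propG (h : PropA μ) : PropG μ := fun u hu => (h u hu).weakly

theorem BallsPosFinite.capacity_eq_one (hμ : BallsPosFinite μ) {G : Set P} (hG : IsOpen G)
    (hne : G.Nonempty) : capacity μ G = 1 := by
  obtain ⟨x, hx⟩ := hne
  obtain ⟨r, hr, hball⟩ := Metric.isOpen_iff.1 hG x hx
  exact le_antisymm (capacity_le_one G) (one_le_capacity_of_measure_ne_zero
    ((hμ x r hr).1.trans_le (measure_mono hball)).ne')

/-- An open exceptional set of capacity below 1 must be empty, so testing with `ε = 1` suffices. -/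
theorem BallsPosFinite.quasicontinuous_iff (hμ : BallsPosFinite μ) {u : P → EReal} :
    Quasicontinuous μ u ↔ IsContOn u univ := by
  refine ⟨fun h => ?_, fun h ε hε => ⟨∅, isOpen_empty, by rwa [capacity_empty], by simpa using h⟩⟩
  obtain ⟨E, hE, hcap, hu⟩ := h 1 one_pos
  rcases E.eq_empty_or_nonempty with rfl | hne
  · simpa using hu
  · exact absurd (hμ.capacity_eq_one hE hne) hcap.ne

theorem PropA.propF (h : PropA μ) : PropF μ := fun u hu =>
  ⟨u, h u hu, by simpa using capacity_empty⟩

variable [BorelSpace P]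

/-- If the capacity of `E` is less than `1`, then `∞ · 1_E` has vanishing Newtonian norm. -/
theorem newtonNorm_indicator_top {E : Set P} (hE : capacity μ E < 1) :
    MemNewton μ (E.indicator fun _ => ⊤) ∧ newtonNorm μ (E.indicator fun _ => ⊤) = 0 := by
  obtain ⟨u, ⟨-, huE⟩, hu⟩ : ∃ u : P → EReal, (MemNewton μ u ∧ ∀ x ∈ E, 1 ≤ u x) ∧
      newtonNorm μ u < 1 := by
    simpa only [capacity, iInf_lt_iff, exists_prop] using hE
  set a := essSup (fun x => (u x).abs) μ with ha
  obtain ⟨g, hg, hgu⟩ : ∃ g, IsUpperGradient g u ∧ a + essSup g μ < 1 := by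
    have ha1 : a ≤ 1 := (lt_of_le_of_lt le_self_add hu).le
    have : (⨅ (g : P → ℝ≥0∞) (_ : IsUpperGradient g u), essSup g μ) < 1 - a :=
      lt_tsub_iff_left.2 hu
    simp only [iInf_lt_iff, exists_prop] at this
    obtain ⟨g, hg, h⟩ := this
    exact ⟨g, hg, lt_tsub_iff_left.1 h⟩
  have ha1 : a < 1 := lt_of_le_of_lt le_self_add hgu
  set b := essSup g μ with hb
  have hae : ∀ᵐ x ∂μ, (u x).abs ≤ a ∧ g x ≤ b :=
    (ENNReal.ae_le_essSup _).and (ENNReal.ae_le_essSup _)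
  set N := toMeasurable μ {x | ¬ ((u x).abs ≤ a ∧ g x ≤ b)} with hNdef
  have hN0 : μ N = 0 := by rw [hNdef, measure_toMeasurable]; exact ae_iff.1 hae
  have hNm : MeasurableSet N := measurableSet_toMeasurable _ _
  have hNu : ∀ x ∉ N, (u x).abs ≤ a ∧ g x ≤ b := fun x hx => by
    by_contra h
    exact hx (subset_toMeasurable μ _ h)
  have hE0 : μ E = 0 := measure_eq_zero_of_one_le huE ha1
  have hupper : IsUpperGradient (N.indicator fun _ => ∞) (E.indicator fun _ => (⊤ : EReal)) := by
    refine ⟨measurable_const.indicator hNm, fun γ l hγ => ?_⟩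
    by_cases h0 : γ 0 ∈ E
    · rw [lintegral_indicator_top_eq_top hg hgu hNm hNu hγ (huE _ h0)]
      exact le_top
    -- The preceding lemma concerns starting points, so a curve ending in `E` is reversed.
    by_cases hl : γ l ∈ E
    · rw [← setLIntegral_reverse (fun t => N.indicator (fun _ => ∞) (γ t)),
        lintegral_indicator_top_eq_top hg hgu hNm hNu hγ.reverse (huE _ (by simpa using hl))]
      exact le_top
    · simp [h0, hl]
  have hEae : (E.indicator fun _ => (⊤ : EReal)) =ᵐ[μ] 0 :=
    indicator_meas_zero hE0
  have hnorm : newtonNorm μ (E.indicator fun _ => (⊤ : EReal)) = 0 := by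
    refine add_eq_zero.2 ⟨?_, ?_⟩
    · rw [ENNReal.essSup_eq_zero_iff]
      filter_upwards [hEae] with x hx
      simp [hx]
    · refine le_antisymm ((iInf₂_le (N.indicator fun _ => ∞) hupper).trans_eq ?_) zero_le
      rw [ENNReal.essSup_eq_zero_iff]
      exact indicator_meas_zero hN0
  exact ⟨⟨measurable_const.nullMeasurable.congr hEae.symm, by simp [hnorm]⟩, hnorm⟩

theorem capacity_eq_zero_of_lt_one {E : Set P} (hE : capacity μ E < 1) : capacity μ E = 0 := by
  obtain ⟨h, h0⟩ := newtonNorm_indicator_top hE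
  refine le_antisymm ((capacity_le h fun x hx => ?_).trans_eq h0) zero_le
  simp [hx]

/-- Quasicontinuous functions are finite everywhere, so `∞ · 1_E` can be one only for empty `E`. -/
theorem propH_of_indicator_top (hμ : BallsPosFinite μ)
    (h : ∀ E : Set P, capacity μ E = 0 → Quasicontinuous μ (E.indicator fun _ => ⊤)) :
    PropH μ := by
  rintro E ⟨x, hx⟩
  rw [pos_iff_ne_zero]
  intro h0
  exact ((hμ.quasicontinuous_iff.1 (h E h0)).1 x (mem_univ x)).2 (by simp [hx])

theorem PropA.propH (hμ : BallsPosFinite μ) (h : PropA μ) : PropH μ :=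
  propH_of_indicator_top hμ fun _ hE => h _ (newtonNorm_indicator_top (hE ▸ one_pos)).1

theorem PropD.propH (hμ : BallsPosFinite μ) (h : PropD μ) : PropH μ := by
  refine propH_of_indicator_top hμ fun E hE => h _ fun ε hε => ⟨E, hE ▸ hε, ?_, ?_⟩
  · intro x hx
    rw [indicator_of_notMem hx]
    exact ⟨EReal.zero_ne_bot, EReal.zero_ne_top⟩
  · exact continuousOn_const.congr fun x hx => indicator_of_notMem hx _

theorem PropC.propH (hμ : BallsPosFinite μ) (h : PropC μ) : PropH μ := by
  obtain ⟨c, -, hc⟩ := h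
  rintro E ⟨x, hx⟩
  rw [pos_iff_ne_zero]
  intro h0
  have h1 := hc E
  have h2 : 1 ≤ ⨅ (G : Set P) (_ : IsOpen G ∧ E ⊆ G), capacity μ G :=
    le_iInf₂ fun G hG => (hμ.capacity_eq_one hG.1 ⟨x, hG.2 hx⟩).ge
  rw [h0, mul_zero] at h1
  simpa using h2.trans h1

theorem PropE.propH (hμ : BallsPosFinite μ) (h : PropE μ) : PropH μ := by
  rintro E ⟨x, hx⟩
  rw [pos_iff_ne_zero]
  intro h0
  obtain ⟨G, hG, hEG, hcap⟩ := h E h0 1 one_pos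
  exact hcap.ne (hμ.capacity_eq_one hG ⟨x, hEG hx⟩)

theorem PropH.eq_empty (h : PropH μ) {E : Set P} (hE : capacity μ E < 1) : E = ∅ := by
  by_contra hne
  exact (h E (nonempty_iff_ne_empty.2 hne)).ne' (capacity_eq_zero_of_lt_one hE)

theorem PropH.propB (h : PropH μ) : PropB μ := by
  intro E
  rw [ENNReal.coe_one, one_mul]
  by_cases hE : capacity μ E < 1
  · exact iInf₂_le E ⟨h.eq_empty hE ▸ isOpen_empty, Subset.rfl⟩
  -- Here the capacity of `E` is already maximal, so the whole space serves as `G`.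
  · exact (iInf₂_le univ ⟨isOpen_univ, subset_univ E⟩).trans
      ((capacity_le_one univ).trans (not_lt.1 hE))

theorem PropH.propD (h : PropH μ) : PropD μ := by
  intro u hu ε hε
  obtain ⟨E, hE, hcont⟩ := hu (min ε 1) (lt_min hε one_pos)
  exact ⟨E, h.eq_empty (hE.trans_le (min_le_right _ _)) ▸ isOpen_empty,
    hE.trans_le (min_le_left _ _), hcont⟩

theorem PropH.propE (h : PropH μ) : PropE μ := fun E hE _ hε =>
  ⟨E, h.eq_empty (hE ▸ one_pos) ▸ isOpen_empty, Subset.rfl, hE ▸ hε⟩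

theorem tfae_outer (hμ : BallsPosFinite μ) :
    List.TFAE [PropB μ, PropC μ, PropD μ, PropE μ, PropH μ] := by
  tfae_have 1 → 2 := fun h => ⟨1, le_rfl, h⟩
  tfae_have 2 → 5 := fun h => h.propH hμ
  tfae_have 3 → 5 := fun h => h.propH hμ
  tfae_have 4 → 5 := fun h => h.propH hμ
  tfae_have 5 → 1 := fun h => h.propB
  tfae_have 5 → 3 := fun h => h.propD
  tfae_have 5 → 4 := fun h => h.propE
  tfae_finish

theorem propA_iff (hμ : BallsPosFinite μ) : PropA μ ↔ PropB μ ∧ PropG μ :=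
  ⟨fun h => ⟨(h.propH hμ).propB, h.propG⟩,
    fun h u hu => (((tfae_outer hμ).out 0 2 : PropB μ ↔ PropD μ).1 h.1) u (h.2 u hu)⟩

theorem PropF.propG (hμ : BallsPosFinite μ) (h : PropF μ) : PropG μ := by
  intro u hu ε hε
  obtain ⟨v, hv, h0⟩ := h u hu
  obtain ⟨hfin, hcont⟩ := hμ.quasicontinuous_iff.1 hv
  have heq : EqOn u v {x | v x ≠ u x}ᶜ := fun x hx => (not_not.1 hx).symm
  exact ⟨_, h0 ▸ hε, fun x hx => heq hx ▸ hfin x (mem_univ x),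
    (hcont.mono (subset_univ _)).congr heq⟩

end General

/-! ### Spaces without rectifiable curves. -/

section TotallyDisconnected

variable {P : Type*} [MetricSpace P] [MeasurableSpace P] {μ : Measure P}

theorem isUpperGradient_zero [TotallyDisconnectedSpace P] (u : P → EReal) : IsUpperGradient 0 u :=
  ⟨measurable_zero, fun γ l h => (not_isArcLengthCurve γ l h).elim⟩

theorem memNewton_indicator_one [BorelSpace P] [TotallyDisconnectedSpace P] {s : Set P}
    (hs : MeasurableSet s) : MemNewton μ (s.indicator fun _ => 1) := by
  refine ⟨(measurable_const.indicator hs).nullMeasurable, ?_⟩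
  rw [newtonNorm_eq_essSup (isUpperGradient_zero _)]
  refine lt_of_le_of_lt (essSup_le_of_ae_le 1 (Filter.Eventually.of_forall fun x => ?_))
    ENNReal.one_lt_top
  have h1 := EReal.abs_def 1
  by_cases hx : x ∈ s
  · simp at h1
    simp [hx, h1]
  · simp [hx]

theorem capacity_eq_zero_of_measure_eq_zero [BorelSpace P] [TotallyDisconnectedSpace P] {E : Set P}
    (hE : μ E = 0) : capacity μ E = 0 := by
  have hae : (E.indicator fun _ => (1 : EReal)) =ᵐ[μ] 0 := indicator_meas_zero hE
  have hnorm : newtonNorm μ (E.indicator fun _ => (1 : EReal)) = 0 := by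
    rw [newtonNorm_eq_essSup (isUpperGradient_zero _), ENNReal.essSup_eq_zero_iff]
    filter_upwards [hae] with x hx
    simp [hx]
  refine le_antisymm ((capacity_le ⟨measurable_const.nullMeasurable.congr hae.symm, by simp [hnorm]⟩
    fun x hx => ?_).trans_eq hnorm) zero_le
  simp [hx]

end TotallyDisconnected

/-! ### Counterexamples. -/

section Examples

/-- On a countable space, every dense set is exactly the set of atoms of some finite measure which
is positive on balls. -/
theorem exists_measure_atoms {P : Type*} [MetricSpace P] [MeasurableSpace P] [BorelSpace P]
    [Countable P] {A : Set P} (hA : Dense A) :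
    ∃ μ : Measure P, BallsPosFinite μ ∧ ∀ s : Set P, μ s = 0 ↔ Disjoint s A := by
  have hAm : MeasurableSet A := A.to_countable.measurableSet
  -- `toFinite` makes all balls finite while keeping the null sets of counting measure on `A`.
  have key (s : Set P) : (Measure.count.restrict A).toFinite s = 0 ↔ Disjoint s A := by
    rw [disjoint_iff_inter_eq_empty, ← Measure.count_eq_zero_iff, ← Measure.restrict_apply' hAm]
    exact ⟨fun h => absolutelyContinuous_toFinite _ h, fun h => toFinite_absolutelyContinuous _ h⟩
  refine ⟨_, fun x r hr => ⟨?_, measure_lt_top _ _⟩, key⟩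
  rw [pos_iff_ne_zero, Ne, key, not_disjoint_iff]
  obtain ⟨y, hy, hyA⟩ := hA.exists_mem_open Metric.isOpen_ball ⟨x, Metric.mem_ball_self hr⟩
  exact ⟨y, hyA, hy⟩

/-- When every rational is an atom, (H) holds and weak quasicontinuity means continuity; the
indicator of a non-isolated point violates it. -/
theorem existsSpace_propB_not_propG : ExistsSpace fun _ _ _ μ => PropB μ ∧ ¬ PropG μ := by
  obtain ⟨μ, hμ, hnull⟩ := exists_measure_atoms (dense_univ (X := ℚ))
  refine ⟨ℚ, inferInstance, inferInstance, inferInstance, μ, hμ, ?_⟩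
  have hH : PropH μ := fun E hE => one_pos.trans_le <| one_le_capacity_of_measure_ne_zero <| by
    rwa [Ne, hnull, disjoint_univ, ← Ne, ← nonempty_iff_ne_empty]
  refine ⟨hH.propB, fun hG => ?_⟩
  have hmem := memNewton_indicator_one (μ := μ) (measurableSet_singleton (0 : ℚ))
  obtain ⟨-, hcont⟩ := hμ.quasicontinuous_iff.1 (hH.propD _ (hG _ hmem))
  rw [continuousOn_univ] at hcont
  have hopen : IsOpen ({0} : Set ℚ) := by
    convert isOpen_Ioi.preimage hcont (t := Ioi (0 : EReal)) using 1
    ext x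
    by_cases hx : x = 0 <;> simp [hx]
  exact not_isOpen_singleton (0 : ℚ) hopen

/-- A convergent sequence together with its limit, the limit being the only point of measure
zero. -/
theorem propG_and_not_propF_of_sequence {P : Type*} [MetricSpace P] [MeasurableSpace P]
    [BorelSpace P] [Countable P] {e : ℕ → P} {p : P} (hinj : e.Injective)
    (htend : Filter.Tendsto e Filter.atTop (nhds p)) (hopen : ∀ n, IsOpen {e n})
    (hrange : range e = {p}ᶜ) :
    ∃ μ : Measure P, BallsPosFinite μ ∧ PropG μ ∧ ¬ PropF μ := by
  have hdense : Dense (range e) := by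
    intro x
    by_cases hx : x ∈ range e
    · exact subset_closure hx
    · obtain rfl : x = p := by simpa [hrange] using hx
      exact mem_closure_of_tendsto htend (Filter.Eventually.of_forall mem_range_self)
  obtain ⟨μ, hμ, hnull⟩ := exists_measure_atoms hdense
  have hp : μ {p} = 0 := by
    rw [hnull, hrange]
    exact disjoint_compl_right
  have hatom (x : P) (hx : x ≠ p) {s : Set P} (hs : μ s = 0) : x ∉ s := fun hxs =>
    disjoint_left.1 ((hnull s).1 hs) hxs (by simpa [hrange] using hx)
  -- Removing the null point `p` leaves a discrete space of atoms, where every `u` of finite norm is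
  -- real-valued and continuous.
  refine ⟨μ, hμ, fun u hu ε hε => ⟨{p}, ?_, fun x hx => ?_, fun x hx => ?_⟩, fun hF => ?_⟩
  · rwa [capacity_eq_zero_of_measure_eq_zero hp]
  · have hess : essSup (fun x => (u x).abs) μ < ∞ := lt_of_le_of_lt le_self_add hu.2
    have hfin := not_not.1 (hatom x hx (ae_iff.1 (ae_lt_of_essSup_lt hess)))
    constructor <;> intro h <;> simp [h] at hfin
  · obtain ⟨n, rfl⟩ : x ∈ range e := hrange ▸ hx
    refine ContinuousAt.continuousWithinAt ?_
    rw [ContinuousAt, isOpen_singleton_iff_nhds_eq_pure _ |>.1 (hopen n)]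
    exact tendsto_pure_nhds _ _
  -- The indicator of the even terms has no continuous representative: atoms fix `v` on the
  -- sequence, and the even and odd subsequences force different values at `p`.
  · set s : Set P := range fun k => e (2 * k) with hs
    obtain ⟨v, hv, h0⟩ := hF _ (memNewton_indicator_one (μ := μ) s.to_countable.measurableSet)
    obtain ⟨-, hcont⟩ := hμ.quasicontinuous_iff.1 hv
    rw [continuousOn_univ] at hcont
    have hnull0 : μ {x | v x ≠ s.indicator (fun _ => 1) x} = 0 := by
      by_contra h
      exact absurd (one_le_capacity_of_measure_ne_zero h) (by simp [h0])
    have hve (n : ℕ) : v (e n) = s.indicator (fun _ => 1) (e n) :=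
      not_not.1 (hatom (e n) (by simpa [hrange] using mem_range_self (f := e) n) hnull0)
    have hlim := (hcont.tendsto p).comp htend
    have heven : v p = 1 := by
      refine tendsto_nhds_unique
        (hlim.comp (Filter.tendsto_id.const_mul_atTop' (r := 2) two_pos)) ?_
      refine tendsto_const_nhds.congr fun k => ?_
      simp [hve, hs]
    have hodd : v p = 0 := by
      refine tendsto_nhds_unique (hlim.comp (Filter.tendsto_atTop_mono
        (fun k => (by omega : k ≤ 2 * k + 1)) Filter.tendsto_id)) ?_
      refine tendsto_const_nhds.congr fun k => ?_
      have : e (2 * k + 1) ∉ s := by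
        rintro ⟨j, hj⟩
        have := hinj hj
        omega
      simp [hve, this]
    simp [heven] at hodd

theorem existsSpace_propG_not_propF : ExistsSpace fun _ _ _ μ => PropG μ ∧ ¬ PropF μ := by
  let _ : MetricSpace (OnePoint ℕ) := TopologicalSpace.metrizableSpaceMetric (OnePoint ℕ)
  let _ : MeasurableSpace (OnePoint ℕ) := borel _
  have : BorelSpace (OnePoint ℕ) := ⟨rfl⟩
  obtain ⟨μ, hμ, h⟩ := propG_and_not_propF_of_sequence (e := ((↑) : ℕ → OnePoint ℕ))
    (p := OnePoint.infty) OnePoint.coe_injective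
    (by simpa using OnePoint.tendsto_coe_infty (X := ℕ))
    (fun n => by simpa using OnePoint.isOpen_image_coe.2 (isOpen_discrete {n}))
    OnePoint.compl_infty.symm
  exact ⟨OnePoint ℕ, _, _, this, μ, hμ, h⟩

theorem totallyDisconnectedSpace_irrational : TotallyDisconnectedSpace {x : ℝ // Irrational x} := by
  refine ⟨fun t _ ht x hx y hy => ?_⟩
  by_contra hne
  have himg : (Subtype.val '' t).OrdConnected :=
    (ht.image _ continuous_subtype_val.continuousOn).ordConnected
  have key (a b : {x : ℝ // Irrational x}) (ha : a ∈ t) (hb : b ∈ t) (hab : a.1 < b.1) : False := by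
    obtain ⟨q, hq⟩ := exists_rat_btwn hab
    obtain ⟨z, -, hz⟩ := himg.out (mem_image_of_mem _ ha) (mem_image_of_mem _ hb)
      ⟨hq.1.le, hq.2.le⟩
    exact z.2 ⟨q, hz.symm⟩
  rcases lt_or_gt_of_ne (Subtype.coe_injective.ne hne) with h | h
  · exact key x y hx hy h
  · exact key y x hy hx h

/-- The restriction of the Lebesgue measure to the irrational numbers. -/
noncomputable def irrationalVolume : Measure {x : ℝ // Irrational x} :=
  Measure.comap Subtype.val volume

theorem irrationalVolume_ball (x : {x : ℝ // Irrational x}) (r : ℝ) :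
    irrationalVolume (Metric.ball x r) = ENNReal.ofReal (2 * r) := by
  have hm : MeasurableSet {x : ℝ | Irrational x} :=
    (countable_range ((↑) : ℚ → ℝ)).measurableSet.compl
  have himg : Subtype.val '' Metric.ball x r = Metric.ball x.1 r \ range ((↑) : ℚ → ℝ) := by
    ext y
    simp only [mem_image, Metric.mem_ball, Subtype.exists, mem_sdiff]
    constructor
    · rintro ⟨z, hz, hd, rfl⟩
      exact ⟨hd, hz⟩
    · rintro ⟨hd, hy⟩
      exact ⟨y, hy, hd, rfl⟩
  have := comap_subtype_coe_apply hm volume (Metric.ball x r : Set {x : ℝ | Irrational x})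
  erw [himg, measure_sdiff_null ((countable_range _).measure_zero _), Real.volume_ball] at this
  exact this

theorem irrationalVolume_singleton (x : {x : ℝ // Irrational x}) : irrationalVolume {x} = 0 := by
  have hm : MeasurableSet {x : ℝ | Irrational x} :=
    (countable_range ((↑) : ℚ → ℝ)).measurableSet.compl
  have := comap_subtype_coe_apply hm volume ({x} : Set {x : ℝ | Irrational x})
  rw [image_singleton, Real.volume_singleton] at this
  exact this

/-- The atom `a` cannot be removed by a set of small capacity, yet every neighbourhood of it has
positive Lebesgue measure, so the jump of `1_{a}` persists. The null point `b` refutes (H). -/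
theorem existsSpace_not_propG_not_propH : ExistsSpace fun _ _ _ μ => ¬ PropG μ ∧ ¬ PropH μ := by
  have := totallyDisconnectedSpace_irrational
  let a : {x : ℝ // Irrational x} := ⟨√2, irrational_sqrt_two⟩
  let b : {x : ℝ // Irrational x} := ⟨-√2, irrational_sqrt_two.neg⟩
  have hba : b ≠ a := by
    intro h
    have h2 : -√2 = √2 := congrArg Subtype.val h
    have h3 : (0 : ℝ) < √2 := by positivity
    linarith
  have hμ : BallsPosFinite (irrationalVolume + Measure.dirac a) := fun x r hr => by
    rw [Measure.add_apply, irrationalVolume_ball]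
    refine ⟨lt_of_lt_of_le ?_ le_self_add, by finiteness⟩
    simpa using hr
  refine ⟨_, inferInstance, inferInstance, inferInstance, irrationalVolume + Measure.dirac a, hμ,
    fun hG => ?_, fun hH => ?_⟩
  · obtain ⟨E, hE, -, hcont⟩ := hG _ (memNewton_indicator_one (measurableSet_singleton a)) 1 one_pos
    have hE0 : (irrationalVolume + Measure.dirac a) E = 0 := by
      by_contra h
      exact hE.not_ge (one_le_capacity_of_measure_ne_zero h)
    rw [Measure.add_apply, add_eq_zero] at hE0
    have haE : a ∉ E := fun h => by
      have := hE0.2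
      simp [h] at this
    have hnhds : {x | 0 < ({a} : Set {x : ℝ // Irrational x}).indicator (fun _ => (1 : EReal)) x} ∈
        nhdsWithin a Eᶜ :=
      (hcont a haE).eventually (lt_mem_nhds (by simp))
    obtain ⟨r, hr, hball⟩ := Metric.mem_nhdsWithin_iff.1 hnhds
    -- Continuity off `E` would keep the indicator positive near `a`, confining a whole ball to a
    -- Lebesgue null set.
    have hsub : Metric.ball a r ⊆ E ∪ {a} := by
      intro x hx
      by_contra h
      rw [mem_union, not_or] at h
      have := hball ⟨hx, h.1⟩
      rw [mem_ofPred_eq, indicator_of_notMem h.2] at this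
      exact lt_irrefl _ this
    have h0 := measure_mono_null hsub (measure_union_null hE0.1 (irrationalVolume_singleton a))
    rw [irrationalVolume_ball, ENNReal.ofReal_eq_zero] at h0
    linarith
  · refine (hH {b} (singleton_nonempty b)).ne' (capacity_eq_zero_of_measure_eq_zero ?_)
    rw [Measure.add_apply, irrationalVolume_singleton, zero_add]
    simp [hba.symm]

theorem ExistsSpace.mono
    {Q R : ∀ (P : Type) [MetricSpace P] [MeasurableSpace P], Measure P → Prop}
    (hQ : ExistsSpace Q)
    (h : ∀ (P : Type) [MetricSpace P] [MeasurableSpace P] [BorelSpace P] (μ : Measure P),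
      BallsPosFinite μ → Q P μ → R P μ) : ExistsSpace R :=
  let ⟨P, _, _, _, μ, hμ, hQμ⟩ := hQ
  ⟨P, _, _, ‹_›, μ, hμ, h P μ hμ hQμ⟩

end Examples

end NewtonianLinfty

theorem theorem1p4 :
    (∀ (P : Type*) [MetricSpace P] [MeasurableSpace P] [BorelSpace P]
        (μ : MeasureTheory.Measure P), NewtonianLinfty.BallsPosFinite μ →
      List.TFAE [NewtonianLinfty.PropB μ, NewtonianLinfty.PropC μ, NewtonianLinfty.PropD μ,
        NewtonianLinfty.PropE μ, NewtonianLinfty.PropH μ] ∧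
      (NewtonianLinfty.PropA μ ↔ NewtonianLinfty.PropB μ ∧ NewtonianLinfty.PropG μ) ∧
      (NewtonianLinfty.PropA μ → NewtonianLinfty.PropB μ) ∧
      (NewtonianLinfty.PropA μ → NewtonianLinfty.PropF μ) ∧
      (NewtonianLinfty.PropF μ → NewtonianLinfty.PropG μ)) ∧
    NewtonianLinfty.ExistsSpace (fun P _ _ μ =>
      NewtonianLinfty.PropB μ ∧ ¬ NewtonianLinfty.PropA μ) ∧
    NewtonianLinfty.ExistsSpace (fun P _ _ μ =>
      NewtonianLinfty.PropG μ ∧ ¬ NewtonianLinfty.PropB μ) ∧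
    NewtonianLinfty.ExistsSpace (fun P _ _ μ =>
      NewtonianLinfty.PropB μ ∧ ¬ NewtonianLinfty.PropG μ) ∧
    NewtonianLinfty.ExistsSpace (fun P _ _ μ =>
      NewtonianLinfty.PropG μ ∧ ¬ NewtonianLinfty.PropF μ) ∧
    NewtonianLinfty.ExistsSpace (fun P _ _ μ =>
      ¬ NewtonianLinfty.PropA μ ∧ ¬ NewtonianLinfty.PropB μ ∧ ¬ NewtonianLinfty.PropC μ ∧
      ¬ NewtonianLinfty.PropD μ ∧ ¬ NewtonianLinfty.PropE μ ∧ ¬ NewtonianLinfty.PropF μ ∧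
      ¬ NewtonianLinfty.PropG μ ∧ ¬ NewtonianLinfty.PropH μ) := by
  open NewtonianLinfty in
  refine ⟨fun P _ _ _ μ hμ => ⟨tfae_outer hμ, propA_iff hμ, fun h => ((propA_iff hμ).1 h).1,
    PropA.propF, PropF.propG hμ⟩, ?_, ?_, existsSpace_propB_not_propG,
    existsSpace_propG_not_propF, ?_⟩
  · exact existsSpace_propB_not_propG.mono fun _ _ _ _ μ _ h => ⟨h.1, fun hA => h.2 hA.propG⟩
  · exact existsSpace_propG_not_propF.mono fun _ _ _ _ μ hμ h =>
      ⟨h.1, fun hB => h.2 ((propA_iff hμ).2 ⟨hB, h.1⟩).propF⟩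
  · exact existsSpace_not_propG_not_propH.mono fun _ _ _ _ μ hμ h =>
      have hH {p : Prop} (hp : p ↔ PropH μ) : ¬ p := fun h' => h.2 (hp.1 h')
      have htfae := tfae_outer hμ
      ⟨fun hA => h.1 hA.propG, hH (htfae.out 0 4), hH (htfae.out 1 4), hH (htfae.out 2 4),
        hH (htfae.out 3 4), fun hF => h.1 (hF.propG hμ), h.1, h.2⟩
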